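/- Let $X$ be a compact connected (Hausdorff) complex manifold, $E$ a holomorphic vector bundle of finite rank on $X$, and $\mathcal{E}$ the associated locally free sheaf of $\mathcal{O}_X$-modules of holomorphic sections of $E$. Let $\mathrm{Aut}(E)$ be the group of holomorphic vector bundle automorphisms of $E$ over $\mathrm{id}_X$, and $\mathrm{Aut}(\mathcal{E})$ the group of automorphisms of the $\mathcal{O}_X$-module $\mathcal{E}$. Then: 1. The natural homomorphism $\mathrm{Aut}(E)\to\mathrm{Aut}(\mathcal{E})$, given by the action of automorphisms on local sections, is an isomorphism. 2. The complex vector space $V=H^0(X,\mathrm{End}(E))$ of global holomorphic sections of the endomorphism bundle is finite dimensional, and the natural map $\mathrm{Aut}(E)\to V$ is injective. 3. For every $x_0\in X$ the function $\delta_{x_0}:V\to\mathbb{C}$, $\delta_{x_0}(f)=\det(f(x_0))$, is a polynomial function, and the image of $\mathrm{Aut}(E)$ in $V$ is the Zariski open set $\{f\in V : \delta_{x_0}(f)\neq 0\}$. 4. With the algebra $A$ of regular functions of this Zariski open subset of $V$ (the functions that are, locally in the Zariski topology, quotients of polynomial functions on $V$), $\mathrm{Aut}(E)$ is an affine algebraic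 group: $A$ is a finitely generated $\mathbb{C}$-algebra, every $\mathbb{C}$-algebra homomorphism $A\to\mathbb{C}$ is evaluation at a unique element of $\mathrm{Aut}(E)$, and the composition $\mathrm{Aut}(E)\times\mathrm{Aut}(E)\to\mathrm{Aut}(E)$ and the inversion $\mathrm{Aut}(E)\to\mathrm{Aut}(E)$ are regular, i.e. for $a\in A$ the function $(\varphi,\psi)\mapsto a(\varphi\circ\psi)$ is a finite sum of functions $b(\varphi)c(\psi)$ with $b,c\in A$, and $\varphi\mapsto a(\varphi^{-1})$ lies in $A$. -/

import Mathlib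

open Bundle TopologicalSpace
open scoped Manifold ContDiff Bundle

noncomputable section

/-! ## Affine algebraic groups over `ℂ` -/

/-- A group `G` with an algebra `A` of complex valued functions on it is an *affine algebraic group*
(with coordinate ring `A`): `A` is a finitely generated algebra, the points of `G` are exactly the
`ℂ`-algebra homomorphisms `A → ℂ` (so that `G` is the affine variety with ring of regular functions
`A`), and the multiplication `G × G → G` and the inversion `G → G` are regular, i.e. they pull `A`
back into `A ⊗ A` (viewed as functions on `G × G`) and into `A`. -/
structure IsAffineAlgebraicGroup {G : Type*} [Group G] (A : Subalgebra ℂ (G → ℂ)) : Prop where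
  finitelyGenerated : A.FG
  points : ∀ χ : A →ₐ[ℂ] ℂ, ∃! g : G, ∀ f : A, χ f = (f : G → ℂ) g
  regular_mul : ∀ f ∈ A, ∃ (m : ℕ) (a b : Fin m → A),
    ∀ g h : G, f (g * h) = ∑ i, (a i : G → ℂ) g * (b i : G → ℂ) h
  regular_inv : ∀ f ∈ A, (fun g : G => f g⁻¹) ∈ A

/-- The algebra of polynomial functions on a complex vector space: the algebra of functions
generated by the linear forms. -/
def polyFunctions (V : Type*) [AddCommGroup V] [Module ℂ V] : Subalgebra ℂ (V → ℂ) :=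
  Algebra.adjoin ℂ (Set.range fun (l : Module.Dual ℂ V) (v : V) => l v)

/-- Let `ι : G → V` be an injection onto a Zariski open subset of a vector space, used to identify
`G` with this subset. A function on `G` is *regular* if it is, locally in the Zariski topology, a
quotient of two polynomial functions. (Near a point, a Zariski neighbourhood on which the
denominator does not vanish can be taken to be the nonvanishing locus of the denominator.) -/
def regularFunctions {G V : Type*} [AddCommGroup V] [Module ℂ V] (ι : G → V) :
    Subalgebra ℂ (G → ℂ) where
  carrier := {g | ∀ P : G, ∃ p ∈ polyFunctions V, ∃ q ∈ polyFunctions V,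
    q (ι P) ≠ 0 ∧ ∀ Q : G, q (ι Q) ≠ 0 → g Q = p (ι Q) / q (ι Q)}
  mul_mem' := by
    intro a b ha hb P
    obtain ⟨p, hp, q, hq, h0, h⟩ := ha P
    obtain ⟨p', hp', q', hq', h0', h'⟩ := hb P
    refine ⟨p * p', mul_mem hp hp', q * q', mul_mem hq hq', mul_ne_zero h0 h0', fun Q hQ => ?_⟩
    have h1 := left_ne_zero_of_mul hQ
    have h2 := right_ne_zero_of_mul hQ
    simp only [Pi.mul_apply]
    rw [h Q h1, h' Q h2, div_mul_div_comm]
  add_mem' := by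
    intro a b ha hb P
    obtain ⟨p, hp, q, hq, h0, h⟩ := ha P
    obtain ⟨p', hp', q', hq', h0', h'⟩ := hb P
    refine ⟨p * q' + q * p', add_mem (mul_mem hp hq') (mul_mem hq hp'), q * q', mul_mem hq hq',
      mul_ne_zero h0 h0', fun Q hQ => ?_⟩
    have h1 := left_ne_zero_of_mul hQ
    have h2 := right_ne_zero_of_mul hQ
    simp only [Pi.mul_apply, Pi.add_apply]
    rw [h Q h1, h' Q h2, div_add_div _ _ h1 h2]
  algebraMap_mem' := by
    intro c P
    exact ⟨algebraMap ℂ _ c, Subalgebra.algebraMap_mem _ c, 1, one_mem _, one_ne_zero,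
      fun Q _ => by simp⟩

/-! ## Holomorphic vector bundles

`X` is a complex manifold modelled on the complex vector space `M`, and `E` is a holomorphic vector
bundle over `X` with model fibre `F`. Holomorphic means complex analytic, `ContMDiff` of order `ω`
over `ℂ`. -/

section VectorBundle

variable (M : Type*) [NormedAddCommGroup M] [NormedSpace ℂ M]
  {X : Type*} [TopologicalSpace X] [ChartedSpace M X]
  (F : Type*) [NormedAddCommGroup F] [NormedSpace ℂ F]
  (E : X → Type*) [TopologicalSpace (TotalSpace F E)]
  [∀ x, TopologicalSpace (E x)] [∀ x, AddCommGroup (E x)] [∀ x, Module ℂ (E x)]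
  [FiberBundle F E]

/-- The group `Aut(E)` consists of the holomorphic vector bundle automorphisms of `E` over the
identity of `X`: families of linear isomorphisms of the fibres such that the induced map of the
total space and its inverse are holomorphic. -/
@[ext]
structure BundleAut where
  toFun : ∀ x, E x ≃L[ℂ] E x
  holomorphic : ContMDiff (𝓘(ℂ, M).prod 𝓘(ℂ, F)) (𝓘(ℂ, M).prod 𝓘(ℂ, F)) ω
    (fun p : TotalSpace F E => (⟨p.1, toFun p.1 p.2⟩ : TotalSpace F E))
  holomorphic_symm : ContMDiff (𝓘(ℂ, M).prod 𝓘(ℂ, F)) (𝓘(ℂ, M).prod 𝓘(ℂ, F)) ω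
    (fun p : TotalSpace F E => (⟨p.1, (toFun p.1).symm p.2⟩ : TotalSpace F E))

/-- The group law is composition. -/
instance BundleAut.instGroup : Group (BundleAut M F E) where
  mul φ ψ := ⟨fun x => (ψ.toFun x).trans (φ.toFun x), φ.holomorphic.comp ψ.holomorphic,
    ψ.holomorphic_symm.comp φ.holomorphic_symm⟩
  one := ⟨fun x => ContinuousLinearEquiv.refl ℂ (E x), contMDiff_id, contMDiff_id⟩
  inv φ := ⟨fun x => (φ.toFun x).symm, φ.holomorphic_symm, φ.holomorphic⟩
  mul_assoc _ _ _ := rfl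
  one_mul _ := rfl
  mul_one _ := rfl
  inv_mul_cancel φ := by
    apply BundleAut.ext
    funext x
    exact ContinuousLinearEquiv.self_trans_symm (φ.toFun x)

section Endomorphisms

variable [VectorBundle ℂ F E] [∀ x, IsTopologicalAddGroup (E x)] [∀ x, ContinuousSMul ℂ (E x)]

/-- `H⁰(X, End E)`: the complex vector space of holomorphic sections of the bundle
`End E = Hom(E, E)`. -/
abbrev EndSections : Type _ :=
  ContMDiffSection 𝓘(ℂ, M) (F →L[ℂ] F) ω (fun x => E x →L[ℂ] E x)

variable {E}

/-- The function `δ_x : H⁰(X, End E) → ℂ`, `f ↦ det (f x)`. -/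
def detAt (x : X) (f : EndSections M F E) : ℂ :=
  LinearMap.det (f x : E x →ₗ[ℂ] E x)

variable {M F} [FiniteDimensional ℂ F]

/-- A bundle endomorphism whose total map is holomorphic is a holomorphic section of `End E`. -/
theorem contMDiff_end_section [IsManifold 𝓘(ℂ, M) ω X] [ContMDiffVectorBundle ω F E 𝓘(ℂ, M)]
    (f : ∀ x, E x →L[ℂ] E x)
    (hf : ContMDiff (𝓘(ℂ, M).prod 𝓘(ℂ, F)) (𝓘(ℂ, M).prod 𝓘(ℂ, F)) ω
      (fun p : TotalSpace F E => (⟨p.1, f p.1 p.2⟩ : TotalSpace F E))) :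
    ContMDiff 𝓘(ℂ, M) (𝓘(ℂ, M).prod 𝓘(ℂ, F →L[ℂ] F)) ω
      (fun x => TotalSpace.mk' (F →L[ℂ] F) (E := fun x => E x →L[ℂ] E x) x (f x)) := by
  intro x₀
  rw [contMDiffAt_hom_bundle]
  refine ⟨contMDiffAt_id, ?_⟩
  dsimp only
  set A : X → F →L[ℂ] F := fun x => ContinuousLinearMap.inCoordinates F E F E x₀ x x₀ x (f x)
    with hA
  set e := trivializationAt F E x₀ with he
  have hx₀ : x₀ ∈ e.baseSet := FiberBundle.mem_baseSet_trivializationAt' x₀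
  have key : ∀ v : F, ContMDiffAt 𝓘(ℂ, M) 𝓘(ℂ, F) ω (fun x => A x v) x₀ := by
    intro v
    have h1 : ContMDiffAt 𝓘(ℂ, M) (𝓘(ℂ, M).prod 𝓘(ℂ, F)) ω
        (fun x => e.toOpenPartialHomeomorph.symm (x, v)) x₀ := by
      have h2 := (e.contMDiffOn_symm (IB := 𝓘(ℂ, M)) (n := ω)).contMDiffAt
        (x := (x₀, v)) (e.open_target.mem_nhds (e.mem_target.2 hx₀))
      exact h2.comp x₀ (contMDiffAt_id.prodMk contMDiffAt_const)
    have h3 := (hf _).comp x₀ h1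
    have h4 := (e.contMDiffAt_iff (IM := 𝓘(ℂ, M)) (IB := 𝓘(ℂ, M)) (n := ω) (by
      rw [e.mem_source, Function.comp_apply]
      have : (e.toOpenPartialHomeomorph.symm (x₀, v)).proj = x₀ := e.proj_symm_apply' hx₀
      simpa [this] using hx₀)).1 h3
    refine h4.2.congr_of_eventuallyEq ?_
    filter_upwards [e.open_baseSet.mem_nhds hx₀] with x hx
    have : e.toOpenPartialHomeomorph.symm (x, v) = ⟨x, e.symm x v⟩ := by
      exact (e.mk_symm hx v).symm
    rw [Function.comp_apply, this]
    simp only [hA]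
    rw [ContinuousLinearMap.inCoordinates_eq hx hx]
    rfl
  let b := Module.finBasis ℂ F
  let c : Fin (Module.finrank ℂ F) → F →L[ℂ] ℂ := fun i => LinearMap.toContinuousLinearMap (b.coord i)
  have hsum : A = fun x => ∑ i, ContinuousLinearMap.smulRightL ℂ F F (c i) (A x (b i)) := by
    funext x
    ext v
    have h1 : A x v = A x (∑ i, b.repr v i • b i) := by rw [b.sum_repr v]
    rw [h1, map_sum, sum_apply]
    refine Finset.sum_congr rfl fun i _ => ?_
    rw [map_smul]
    rfl
  change ContMDiffAt 𝓘(ℂ, M) 𝓘(ℂ, F →L[ℂ] F) ω A x₀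
  rw [hsum]
  refine contMDiffAt_finsetSum fun i _ => ?_
  exact (ContinuousLinearMap.contMDiff (ContinuousLinearMap.smulRightL ℂ F F (c i))).contMDiffAt.comp
    x₀ (key (b i))

/-- The natural map `Aut(E) → H⁰(X, End E)`. -/
def BundleAut.toEndSection [IsManifold 𝓘(ℂ, M) ω X] [ContMDiffVectorBundle ω F E 𝓘(ℂ, M)]
    (φ : BundleAut M F E) : EndSections M F E :=
  ⟨fun x => (φ.toFun x : E x →L[ℂ] E x), contMDiff_end_section _ φ.holomorphic⟩

end Endomorphisms

/-! ## The locally free sheaf associated with a vector bundle -/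

/-- The ring `𝒪_X(U)` of holomorphic functions on an open set `U`. -/
abbrev HolFun (U : Opens X) : Type _ := ContMDiffMap 𝓘(ℂ, M) 𝓘(ℂ, ℂ) U ℂ ω

variable [VectorBundle ℂ F E]

/-- The space `ℰ(U)` of holomorphic sections of `E` over an open set `U`, as an additive group. -/
def sheafSections (U : Opens X) : AddSubgroup (∀ x : U, E x) where
  carrier := {s | ContMDiff 𝓘(ℂ, M) (𝓘(ℂ, M).prod 𝓘(ℂ, F)) ω
    (fun x : U => (⟨x, s x⟩ : TotalSpace F E))}
  add_mem' := by
    intro s t hs ht x₀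
    have hs := contMDiffAt_totalSpace.1 (hs x₀)
    have ht := contMDiffAt_totalSpace.1 (ht x₀)
    refine contMDiffAt_totalSpace.2 ⟨hs.1, (hs.2.add ht.2).congr_of_eventuallyEq ?_⟩
    filter_upwards [((trivializationAt F E x₀.1).open_baseSet.preimage
      continuous_subtype_val).mem_nhds (FiberBundle.mem_baseSet_trivializationAt' x₀.1)] with x hx
    exact ((trivializationAt F E x₀.1).linear ℂ hx).map_add _ _
  zero_mem' := (contMDiff_zeroSection ℂ E).comp contMDiff_subtype_val
  neg_mem' := by
    intro s hs x₀
    have hs := contMDiffAt_totalSpace.1 (hs x₀)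
    refine contMDiffAt_totalSpace.2 ⟨hs.1, hs.2.neg.congr_of_eventuallyEq ?_⟩
    filter_upwards [((trivializationAt F E x₀.1).open_baseSet.preimage
      continuous_subtype_val).mem_nhds (FiberBundle.mem_baseSet_trivializationAt' x₀.1)] with x hx
    exact ((trivializationAt F E x₀.1).linear ℂ hx).map_neg _

variable {M F E} in
theorem smul_mem_sheafSections {U : Opens X} (a : HolFun M U) {s : ∀ x : U, E x}
    (hs : s ∈ sheafSections M F E U) : (fun x => a x • s x) ∈ sheafSections M F E U := by
  intro x₀
  have hs := contMDiffAt_totalSpace.1 (hs x₀)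
  refine contMDiffAt_totalSpace.2
    ⟨hs.1, (a.contMDiff.contMDiffAt.smul hs.2).congr_of_eventuallyEq ?_⟩
  filter_upwards [((trivializationAt F E x₀.1).open_baseSet.preimage
    continuous_subtype_val).mem_nhds (FiberBundle.mem_baseSet_trivializationAt' x₀.1)] with x hx
  exact ((trivializationAt F E x₀.1).linear ℂ hx).map_smul _ _

/-- `ℰ(U)` is a module over `𝒪_X(U)`. -/
instance sheafSections.instModule (U : Opens X) :
    Module (HolFun M U) (sheafSections M F E U) where
  smul a s := ⟨fun x => a x • s.1 x, smul_mem_sheafSections a s.2⟩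
  one_smul s := Subtype.ext (funext fun x => one_smul ℂ (s.1 x))
  mul_smul a b s := Subtype.ext (funext fun x => mul_smul (a x) (b x) (s.1 x))
  smul_zero a := Subtype.ext (funext fun x => smul_zero (a x))
  smul_add a s t := Subtype.ext (funext fun x => smul_add (a x) (s.1 x) (t.1 x))
  add_smul a b s := Subtype.ext (funext fun x => add_smul (a x) (b x) (s.1 x))
  zero_smul s := Subtype.ext (funext fun x => zero_smul ℂ (s.1 x))

variable {M F E} in
/-- Restriction of sections to a smaller open set. -/
def resSection {U V : Opens X} (h : V ≤ U) (s : sheafSections M F E U) :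
    sheafSections M F E V :=
  ⟨fun x => s.1 ⟨x, h x.2⟩, ContMDiff.comp s.2 (contMDiff_inclusion h)⟩

/-- `Aut(ℰ)`: the automorphisms of the sheaf `ℰ` as a sheaf of `𝒪_X`-modules. -/
@[ext]
structure SheafAut where
  app : ∀ U : Opens X, sheafSections M F E U ≃ₗ[HolFun M U] sheafSections M F E U
  naturality : ∀ (U V : Opens X) (h : V ≤ U) (s : sheafSections M F E U),
    resSection h (app U s) = app V (resSection h s)

/-- The group law is composition. -/
instance SheafAut.instGroup : Group (SheafAut M F E) where
  mul φ ψ := ⟨fun U => (ψ.app U).trans (φ.app U), fun U V h s => by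
    simp only [LinearEquiv.trans_apply, φ.naturality, ψ.naturality]⟩
  one := ⟨fun _ => LinearEquiv.refl _ _, fun _ _ _ _ => rfl⟩
  inv φ := ⟨fun U => (φ.app U).symm, fun U V h s => by
    apply (φ.app V).injective
    rw [← φ.naturality, LinearEquiv.apply_symm_apply, LinearEquiv.apply_symm_apply]⟩
  mul_assoc _ _ _ := rfl
  one_mul _ := rfl
  mul_one _ := rfl
  inv_mul_cancel φ := by
    apply SheafAut.ext
    funext U
    exact LinearEquiv.self_trans_symm (φ.app U)

/-- The natural homomorphism `Aut(E) → Aut(ℰ)`, which applies a bundle automorphism to sections. -/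
def BundleAut.toSheafAut : BundleAut M F E →* SheafAut M F E where
  toFun φ :=
    { app := fun _ =>
        { toFun := fun s => ⟨fun x => φ.toFun x (s.1 x), φ.holomorphic.comp s.2⟩
          invFun := fun s => ⟨fun x => (φ.toFun x).symm (s.1 x), φ.holomorphic_symm.comp s.2⟩
          map_add' := fun s t => Subtype.ext (funext fun x => map_add (φ.toFun x) (s.1 x) (t.1 x))
          map_smul' := fun a s =>
            Subtype.ext (funext fun x => map_smul (φ.toFun x) (a x) (s.1 x))
          left_inv := fun s =>
            Subtype.ext (funext fun x => (φ.toFun x).symm_apply_apply (s.1 x))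
          right_inv := fun s =>
            Subtype.ext (funext fun x => (φ.toFun x).apply_symm_apply (s.1 x)) }
      naturality := fun _ _ _ _ => rfl }
  map_one' := rfl
  map_mul' _ _ := rfl

end VectorBundle

end

noncomputable section

/-! ## Regular functions on a principal open subset of a vector space -/

section Algebraic

variable {V : Type*} [AddCommGroup V] [Module ℂ V]

/-! For an endomorphism `f` of `E`, the function `x ↦ det (f x)` is holomorphic on a compact
connected manifold, hence constant (`detAt_eq_detAt`). If it is nonzero at one point, `f` is
invertible on every fibre, and the inverse is holomorphic because inversion of operators is analytic
(`contMDiff_symm_apply`). So Aut(E) is the principal open set `δ ≠ 0` in `V = H⁰(X, End E)`.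

`V` is finite dimensional by a Schwarz lemma argument (`exists_compact_nhds_finite_net`): a section
vanishing on a sufficiently fine finite set has its sup bounds halved, over and over, so it is zero.
Evaluation on that finite set is therefore injective.

By the Nullstellensatz the regular functions on `δ ≠ 0` form the ring `ℂ[V][1/δ]`
(`regularFunctions_eq_adjoin`), and the group axioms need checking only on its generators.
Composition is bilinear and `δ` is multiplicative; inversion is regular by Cramer's rule.

For the sheaf, `𝒪`-linearity forces the value of `Φ s` at a point to depend only on the value of `s`
there (`SheafAut.app_apply_eq_zero`), so `Φ` comes from maps of the fibres, holomorphic since they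
send local frames to holomorphic sections. -/

theorem linearForm_mem_polyFunctions (l : Module.Dual ℂ V) :
    (fun v => l v) ∈ polyFunctions V :=
  Algebra.subset_adjoin ⟨l, rfl⟩

theorem polyFunctions_eq_adjoin_coord {κ : Type*} [Fintype κ] (b : Module.Basis κ ℂ V) :
    polyFunctions V = Algebra.adjoin ℂ (Set.range fun (i : κ) (v : V) => b.coord i v) := by
  refine le_antisymm (Algebra.adjoin_le ?_) (Algebra.adjoin_mono ?_)
  · rintro _ ⟨l, rfl⟩
    have : (fun v => l v) = ∑ i, l (b i) • fun v => b.coord i v := by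
      funext v
      conv_lhs => rw [← b.sum_repr v]
      simp only [map_sum, map_smul, smul_eq_mul, Finset.sum_apply, Pi.smul_apply,
        Module.Basis.coord_apply, mul_comm]
    change (fun v => l v) ∈ _
    rw [this]
    exact sum_mem fun i _ => Subalgebra.smul_mem _ (Algebra.subset_adjoin (Set.mem_range_self i)) _
  · rintro _ ⟨i, rfl⟩
    exact ⟨b.coord i, rfl⟩

theorem aeval_coord_apply {κ : Type*} (b : Module.Basis κ ℂ V) (P : MvPolynomial κ ℂ) (v : V) :
    MvPolynomial.aeval (fun (i : κ) (v : V) => b.coord i v) P v =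
      MvPolynomial.aeval (fun i => b.coord i v) P := by
  have := MvPolynomial.comp_aeval_apply (fun (i : κ) (v : V) => b.coord i v)
    (Pi.evalAlgHom ℂ (fun _ : V => ℂ) v) P
  simpa using this

/-- A basis turns the coordinate-free definition into genuine polynomials, to which the
Nullstellensatz applies. -/
theorem mem_polyFunctions_iff {κ : Type*} [Fintype κ] (b : Module.Basis κ ℂ V) {p : V → ℂ} :
    p ∈ polyFunctions V ↔
      ∃ P : MvPolynomial κ ℂ, ∀ v, p v = MvPolynomial.aeval (fun i => b.coord i v) P := by
  rw [polyFunctions_eq_adjoin_coord b, Algebra.adjoin_range_eq_range_aeval, AlgHom.mem_range]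
  refine exists_congr fun P => ⟨?_, fun h => ?_⟩
  · rintro rfl v
    exact aeval_coord_apply b P v
  · funext v
    rw [h v, aeval_coord_apply]

theorem mem_regularFunctions_of_eq_div {G : Type*} {ι : G → V} {g : G → ℂ} {p q : V → ℂ}
    (hp : p ∈ polyFunctions V) (hq : q ∈ polyFunctions V) (h0 : ∀ Q, q (ι Q) ≠ 0)
    (h : ∀ Q, g Q = p (ι Q) / q (ι Q)) : g ∈ regularFunctions ι :=
  fun P => ⟨p, hp, q, hq, h0 P, fun Q _ => h Q⟩

theorem comp_mem_regularFunctions {G : Type*} (ι : G → V) {p : V → ℂ}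
    (hp : p ∈ polyFunctions V) : (fun Q => p (ι Q)) ∈ regularFunctions ι :=
  mem_regularFunctions_of_eq_div hp (one_mem _) (fun _ => one_ne_zero) fun _ => (div_one _).symm

/-- The determinant of a matrix of polynomial functions is a polynomial function. -/
theorem det_mem_polyFunctions {n : Type*} [Fintype n] [DecidableEq n] (A : V → Matrix n n ℂ)
    (hA : ∀ i j, (fun v => A v i j) ∈ polyFunctions V) :
    (fun v => (A v).det) ∈ polyFunctions V := by
  have : (fun v => (A v).det) =
      ∑ σ : Equiv.Perm n, ((Equiv.Perm.sign σ : ℤ) : ℂ) • ∏ i, fun v => A v (σ i) i := by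
    funext v
    simp [Matrix.det_apply']
  rw [this]
  exact sum_mem fun σ _ => Subalgebra.smul_mem _ (prod_mem fun i _ => hA _ _) _

variable {G : Type*} {ι : G → V} {δ : V → ℂ} [FiniteDimensional ℂ V]

/-- A regular function on the principal open set `δ ≠ 0` is a quotient of a polynomial by a power
of `δ`. -/
theorem exists_pow_mul_eq_of_mem_regularFunctions (hδ : δ ∈ polyFunctions V)
    (hrange : Set.range ι = {v | δ v ≠ 0}) {g : G → ℂ} (hg : g ∈ regularFunctions ι) :
    ∃ n : ℕ, ∃ p ∈ polyFunctions V, ∀ Q, δ (ι Q) ^ n * g Q = p (ι Q) := by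
  let b := Module.finBasis ℂ V
  let c : V → Fin (Module.finrank ℂ V) → ℂ := fun v i => b.coord i v
  obtain ⟨D, hD⟩ := (mem_polyFunctions_iff b).1 hδ
  -- The ideal of denominators of `g`. The claim is that some power of `δ` lies in it, i.e. that `δ`
  -- vanishes on its zero locus.
  let J : Ideal (MvPolynomial (Fin (Module.finrank ℂ V)) ℂ) :=
    { carrier := {H | ∃ p ∈ polyFunctions V, ∀ Q, MvPolynomial.aeval (c (ι Q)) H * g Q = p (ι Q)}
      zero_mem' := ⟨0, zero_mem _, fun Q => by simp⟩
      add_mem' := by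
        rintro H K ⟨p, hp, h⟩ ⟨q, hq, k⟩
        exact ⟨p + q, add_mem hp hq, fun Q => by rw [map_add, add_mul, h, k, Pi.add_apply]⟩
      smul_mem' := by
        rintro K H ⟨p, hp, h⟩
        refine ⟨_, mul_mem ((mem_polyFunctions_iff b (p := fun v => MvPolynomial.aeval (c v) K)).2
          ⟨K, fun v => rfl⟩) hp, fun Q => ?_⟩
        rw [smul_eq_mul, map_mul, mul_assoc, h, Pi.mul_apply] }
  have hrad : D ∈ J.radical := by
    rw [← MvPolynomial.vanishingIdeal_zeroLocus_eq_radical (K := ℂ)]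
    intro x hx
    by_contra hne
    let v : V := b.equivFun.symm x
    have hv : c v = x := by
      funext i
      change b.equivFun (b.equivFun.symm x) i = x i
      rw [LinearEquiv.apply_symm_apply]
    obtain ⟨P, hP⟩ : v ∈ Set.range ι := by
      rw [hrange, Set.mem_ofPred_eq, hD]
      change MvPolynomial.aeval (c v) D ≠ 0
      rwa [hv]
    obtain ⟨p, hp, q, hq, h0, h⟩ := hg P
    obtain ⟨H, hH⟩ := (mem_polyFunctions_iff b).1 hq
    -- The identity `q * g = p` is known only where `q ≠ 0`. One more factor `q` makes both sides
    -- vanish elsewhere, so `q ^ 2` is a denominator valid on all of `G`.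
    have hmem : H * H ∈ J := by
      refine ⟨q * p, mul_mem hq hp, fun Q => ?_⟩
      have : MvPolynomial.aeval (c (ι Q)) H = q (ι Q) := (hH (ι Q)).symm
      rw [map_mul, this, Pi.mul_apply, mul_assoc]
      by_cases hQ : q (ι Q) = 0
      · simp [hQ]
      · rw [h Q hQ, mul_div_cancel₀ _ hQ]
    have h2 := hx _ hmem
    rw [map_mul, mul_self_eq_zero, ← hv] at h2
    refine h0 ?_
    rw [hP, hH]
    exact h2
  obtain ⟨n, p, hp, h⟩ := hrad
  refine ⟨n, p, hp, fun Q => ?_⟩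
  rw [← h Q, map_pow, hD]

/-- Every regular function has the form `p / δ ^ n`. The finite generating set gives finite
generation at once and reduces every later check to coordinates and `1 / δ`. -/
theorem regularFunctions_eq_adjoin {κ : Type*} [Fintype κ] (b : Module.Basis κ ℂ V)
    (hδ : δ ∈ polyFunctions V) (hrange : Set.range ι = {v | δ v ≠ 0}) :
    regularFunctions ι = Algebra.adjoin ℂ
      (insert (fun Q => (δ (ι Q))⁻¹) (Set.range fun (i : κ) Q => b.coord i (ι Q))) := by
  have hne (Q : G) : δ (ι Q) ≠ 0 := by
    have : ι Q ∈ Set.range ι := ⟨Q, rfl⟩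
    rwa [hrange] at this
  refine le_antisymm (fun g hg => ?_) (Algebra.adjoin_le ?_)
  · obtain ⟨n, p, hp, h⟩ := exists_pow_mul_eq_of_mem_regularFunctions hδ hrange hg
    have hg' : g = (fun Q => (δ (ι Q))⁻¹) ^ n * fun Q => p (ι Q) := by
      funext Q
      rw [Pi.mul_apply, Pi.pow_apply, ← h Q, inv_pow, inv_mul_cancel_left₀ (pow_ne_zero _ (hne Q))]
    rw [hg']
    refine mul_mem (pow_mem (Algebra.subset_adjoin (Set.mem_insert _ _)) n) ?_
    obtain ⟨P, hP⟩ := (mem_polyFunctions_iff b).1 hp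
    have hp' : (fun Q => p (ι Q)) =
        MvPolynomial.aeval (fun (i : κ) (Q : G) => b.coord i (ι Q)) P := by
      funext Q
      have := MvPolynomial.comp_aeval_apply (fun (i : κ) (Q : G) => b.coord i (ι Q))
        (Pi.evalAlgHom ℂ (fun _ : G => ℂ) Q) P
      rw [hP]
      simpa using this.symm
    rw [hp']
    refine Algebra.adjoin_mono (Set.subset_insert _ _) ?_
    rw [Algebra.adjoin_range_eq_range_aeval]
    exact ⟨P, rfl⟩
  · rintro _ (rfl | ⟨i, rfl⟩)
    · exact mem_regularFunctions_of_eq_div (one_mem _) hδ hne fun Q => (one_div _).symm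
    · exact comp_mem_regularFunctions ι (linearForm_mem_polyFunctions (b.coord i))


-- The functions whose pullback under multiplication lies in the image of `A ⊗ A` form a subalgebra,
-- so it suffices to test generators.
open TensorProduct in
theorem exists_sum_of_mem_adjoin {G : Type*} [Group G] {A : Subalgebra ℂ (G → ℂ)} {S : Set (G → ℂ)}
    (hS : ∀ f ∈ S, ∃ (m : ℕ) (a b : Fin m → A),
      ∀ g h : G, f (g * h) = ∑ i, (a i : G → ℂ) g * (b i : G → ℂ) h)
    {f : G → ℂ} (hf : f ∈ Algebra.adjoin ℂ S) :
    ∃ (m : ℕ) (a b : Fin m → A), ∀ g h : G, f (g * h) = ∑ i, (a i : G → ℂ) g * (b i : G → ℂ) h := by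
  let pull (u : G × G → G) : (G → ℂ) →ₐ[ℂ] (G × G → ℂ) :=
    AlgHom.pi fun x => Pi.evalAlgHom ℂ (fun _ : G => ℂ) (u x)
  let T : TensorProduct ℂ A A →ₐ[ℂ] (G × G → ℂ) := Algebra.TensorProduct.lift
    ((pull Prod.fst).comp A.val) ((pull Prod.snd).comp A.val) fun _ _ => Commute.all _ _
  have hT (a b : A) (x : G × G) : T (a ⊗ₜ b) x = (a : G → ℂ) x.1 * (b : G → ℂ) x.2 := by
    simp only [T, Algebra.TensorProduct.lift_tmul]
    rfl
  have hle : Algebra.adjoin ℂ S ≤ T.range.comap (pull fun x => x.1 * x.2) := by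
    refine Algebra.adjoin_le fun f hf => ?_
    obtain ⟨m, a, b, h⟩ := hS f hf
    refine ⟨∑ i, a i ⊗ₜ b i, funext fun x => ?_⟩
    change T (∑ i, a i ⊗ₜ b i) x = f (x.1 * x.2)
    rw [h, map_sum, Finset.sum_apply]
    exact Finset.sum_congr rfl fun i _ => hT _ _ _
  obtain ⟨t, ht⟩ := hle hf
  obtain ⟨m, a, b, rfl⟩ := TensorProduct.exists_sum_tmul_eq t
  refine ⟨m, a, b, fun g h => ?_⟩
  have := congrFun ht (g, h)
  change T (∑ i, a i ⊗ₜ b i) (g, h) = f (g * h) at this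
  rw [← this, map_sum, Finset.sum_apply]
  exact Finset.sum_congr rfl fun i _ => (hT _ _ _)

theorem map_adjoin_inv_mem {G : Type*} [Group G] {A : Subalgebra ℂ (G → ℂ)} {S : Set (G → ℂ)}
    (hS : ∀ f ∈ S, (fun g => f g⁻¹) ∈ A) {f : G → ℂ} (hf : f ∈ Algebra.adjoin ℂ S) :
    (fun g => f g⁻¹) ∈ A := by
  let inv : (G → ℂ) →ₐ[ℂ] (G → ℂ) :=
    AlgHom.pi fun g => Pi.evalAlgHom ℂ (fun _ : G => ℂ) g⁻¹
  have hle : Algebra.adjoin ℂ S ≤ A.comap inv := Algebra.adjoin_le hS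
  exact hle hf

/-- A group embedded in a finite dimensional vector space as a principal open set, so that the
multiplication is the restriction of a bilinear map, is an affine algebraic group. -/
theorem isAffineAlgebraicGroup_regularFunctions {G : Type*} [Group G] {ι : G → V}
    (hι : Function.Injective ι) (hδ : δ ∈ polyFunctions V)
    (hrange : Set.range ι = {v | δ v ≠ 0}) (hδmul : ∀ g h, δ (ι (g * h)) = δ (ι g) * δ (ι h))
    (m : V →ₗ[ℂ] V →ₗ[ℂ] V) (hm : ∀ g h, m (ι g) (ι h) = ι (g * h))
    (hm_mul : ∀ g h v, m (ι g) (m (ι h) v) = m (ι (g * h)) v) (hm_one : ∀ v, m (ι 1) v = v) :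
    IsAffineAlgebraicGroup (regularFunctions ι) := by
  let b := Module.finBasis ℂ V
  have hadj := regularFunctions_eq_adjoin b hδ hrange
  have hne (Q : G) : δ (ι Q) ≠ 0 := by
    have : ι Q ∈ Set.range ι := ⟨Q, rfl⟩
    rwa [hrange] at this
  have hcoord (l : Module.Dual ℂ V) : (fun g => l (ι g)) ∈ regularFunctions ι :=
    comp_mem_regularFunctions ι (linearForm_mem_polyFunctions l)
  have hδA : (fun g => δ (ι g)) ∈ regularFunctions ι := comp_mem_regularFunctions ι hδ
  have hδ' : (fun g => (δ (ι g))⁻¹) ∈ regularFunctions ι := by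
    rw [hadj]
    exact Algebra.subset_adjoin (Set.mem_insert _ _)
  refine ⟨?_, fun χ => ?_, fun f hf => ?_, fun f hf => ?_⟩
  · rw [hadj]
    exact Subalgebra.fg_def.2 ⟨_, (Set.finite_range _).insert _, rfl⟩
  -- The only candidate point: its coordinates are the values of `χ` on the coordinate functions. As
  -- `δ` is a polynomial in them, `δ v = χ δ`, which is a unit because `δ` is invertible in the
  -- algebra; hence `v` comes from `G`.
  · let v : V := ∑ i, χ ⟨_, hcoord (b.coord i)⟩ • b i
    have hv (i) : b.coord i v = χ ⟨_, hcoord (b.coord i)⟩ := by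
      simp only [v, Module.Basis.coord_apply, b.repr_sum_self]
    have hδv : δ v = χ ⟨_, hδA⟩ := by
      obtain ⟨D, hD⟩ := (mem_polyFunctions_iff b).1 hδ
      have h1 : (⟨_, hδA⟩ : regularFunctions ι) =
          MvPolynomial.aeval (fun i => (⟨_, hcoord (b.coord i)⟩ : regularFunctions ι)) D := by
        apply Subtype.ext
        funext Q
        have := MvPolynomial.comp_aeval_apply
          (fun i => (⟨_, hcoord (b.coord i)⟩ : regularFunctions ι))
          ((Pi.evalAlgHom ℂ (fun _ : G => ℂ) Q).comp (regularFunctions ι).val) D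
        change δ (ι Q) = _
        rw [hD]
        exact this.symm
      rw [h1, MvPolynomial.comp_aeval_apply, hD]
      simp only [hv]
    have hinv : χ ⟨_, hδ'⟩ * δ v = 1 := by
      rw [hδv, ← map_mul, ← map_one χ]
      congr 1
      exact Subtype.ext (funext fun Q => inv_mul_cancel₀ (hne Q))
    obtain ⟨g, hg⟩ : v ∈ Set.range ι := by
      rw [hrange]
      exact right_ne_zero_of_mul_eq_one hinv
    refine ⟨g, fun f => ?_, fun g' hg' => ?_⟩
    · let ev : regularFunctions ι →ₐ[ℂ] ℂ :=
        (Pi.evalAlgHom ℂ (fun _ : G => ℂ) g).comp (regularFunctions ι).val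
      have hle : ∀ x (hx : x ∈ Algebra.adjoin ℂ
          (insert (fun Q => (δ (ι Q))⁻¹) (Set.range fun i Q => b.coord i (ι Q)))),
          χ ⟨x, hadj ▸ hx⟩ = ev ⟨x, hadj ▸ hx⟩ := by
        intro x hx
        induction hx using Algebra.adjoin_induction with
        | mem x hx =>
          rcases hx with rfl | ⟨i, rfl⟩
          · change _ = (δ (ι g))⁻¹
            rw [hg]
            exact eq_inv_of_mul_eq_one_left hinv
          · change _ = b.coord i (ι g)
            rw [hg, hv]
        | algebraMap r => exact (χ.commutes r).trans (ev.commutes r).symm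
        | add x y hx hy h1 h2 =>
          have h3 := congrArg₂ (· + ·) h1 h2
          simp only [← map_add] at h3
          exact h3
        | mul x y hx hy h1 h2 =>
          have h3 := congrArg₂ (· * ·) h1 h2
          simp only [← map_mul] at h3
          exact h3
      exact hle f.1 (hadj ▸ f.2)
    · apply hι
      apply b.ext_elem
      intro i
      rw [hg]
      have := hg' ⟨_, hcoord (b.coord i)⟩
      rw [← hv] at this
      exact this.symm
  · rw [hadj] at hf
    refine exists_sum_of_mem_adjoin ?_ hf
    rintro _ (rfl | ⟨i, rfl⟩)
    · refine ⟨1, fun _ => ⟨_, hδ'⟩, fun _ => ⟨_, hδ'⟩, fun g h => ?_⟩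
      simp [hδmul, mul_comm]
    -- Expand the left factor in the basis: `m (ι g) (ι h) = ∑ j, (b.coord j (ι g)) • m (b j) (ι
    -- h)`.
    · refine ⟨_, fun j => ⟨_, hcoord (b.coord j)⟩,
        fun j => ⟨_, hcoord ((b.coord i).comp (m (b j)))⟩, fun g h => ?_⟩
      dsimp only
      rw [← hm]
      conv_lhs => rw [← b.sum_repr (ι g)]
      simp only [map_sum, map_smul, LinearMap.sum_apply, LinearMap.smul_apply, smul_eq_mul,
        LinearMap.comp_apply, Module.Basis.coord_apply]
  · rw [hadj] at hf
    refine map_adjoin_inv_mem ?_ hf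
    have hmul_inv (g : G) : (m (ι g)).comp (m (ι g⁻¹)) = LinearMap.id := by
      ext v
      simp [hm_mul, hm_one]
    -- Left multiplication by `v`. The vector `ι g⁻¹` solves the linear system `m (ι g) x = ι 1`, so
    -- Cramer's rule writes its coordinates as quotients of polynomials. The denominator is `det (A
    -- v)`, not `δ`; only its nonvanishing on `G` matters.
    let A : V → Matrix (Fin (Module.finrank ℂ V)) (Fin (Module.finrank ℂ V)) ℂ :=
      fun v => LinearMap.toMatrix b b (m v)
    have hA (i j) : (fun v => A v i j) ∈ polyFunctions V := by
      have : (fun v => A v i j) = fun v => (b.coord i).comp (m.flip (b j)) v := by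
        funext v
        simp [A, LinearMap.toMatrix_apply]
      rw [this]
      exact linearForm_mem_polyFunctions _
    have hdet (g : G) : (A (ι g)).det ≠ 0 := by
      have h1 : A (ι g) * A (ι g⁻¹) = 1 := by
        simp only [A]
        rw [← LinearMap.toMatrix_comp, hmul_inv, LinearMap.toMatrix_id]
      have h2 := congrArg Matrix.det h1
      rw [Matrix.det_mul, Matrix.det_one] at h2
      exact left_ne_zero_of_mul_eq_one h2
    rintro _ (rfl | ⟨i, rfl⟩)
    · have : (fun g : G => (δ (ι g⁻¹))⁻¹) = fun g => δ (ι g) * (δ (ι 1))⁻¹ := by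
        funext g
        have h1 := hδmul g g⁻¹
        rw [mul_inv_cancel] at h1
        rw [h1]
        field_simp [hne g, hne g⁻¹]
      change (fun g : G => (δ (ι g⁻¹))⁻¹) ∈ _
      rw [this]
      exact mul_mem hδA (Subalgebra.algebraMap_mem _ ((δ (ι 1))⁻¹))
    · let y : Fin (Module.finrank ℂ V) → ℂ := b.repr (ι 1)
      refine mem_regularFunctions_of_eq_div (p := fun v => ((A v).updateCol i y).det)
        (q := fun v => (A v).det) (det_mem_polyFunctions _ fun j k => ?_)
        (det_mem_polyFunctions _ hA) hdet fun g => ?_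
      · by_cases hk : k = i
        · subst hk
          simp only [Matrix.updateCol_self]
          exact Subalgebra.algebraMap_mem _ (y j)
        · simp only [Matrix.updateCol_ne hk]
          exact hA j k
      · have h1 : (A (ι g)).mulVec (b.repr (ι g⁻¹)) = y := by
          rw [LinearMap.toMatrix_mulVec_repr, hm, mul_inv_cancel]
        change b.repr (ι g⁻¹) i = _
        rw [eq_div_iff (hdet g)]
        have h2 := Matrix.cramer_apply (A (ι g)) y i
        rw [← h2, ← h1, Matrix.cramer_eq_adjugate_mulVec, Matrix.mulVec_mulVec,
          Matrix.adjugate_mul]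
        simp [Matrix.smul_mulVec, mul_comm]

end Algebraic

/-! ## Finiteness of the space of holomorphic sections -/

section Finiteness

/-- Schwarz lemma on the ball of radius `R` about the zero `p`, which stays inside the ball of
radius `2 * R` about `c`. -/
theorem norm_le_div_mul_dist_of_eq_zero {M F : Type*} [NormedAddCommGroup M] [NormedSpace ℂ M]
    [NormedAddCommGroup F] [NormedSpace ℂ F] {u : M → F} {c z p : M} {R B : ℝ}
    (hu : DifferentiableOn ℂ u (Metric.ball c (2 * R)))
    (hB : ∀ w ∈ Metric.ball c (2 * R), ‖u w‖ ≤ B) (hp : p ∈ Metric.closedBall c R) (h0 : u p = 0)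
    (hz : z ∈ Metric.ball p R) : ‖u z‖ ≤ B / R * dist z p := by
  have hsub : Metric.ball p R ⊆ Metric.ball c (2 * R) := by
    refine Metric.ball_subset_ball' ?_
    rw [Metric.mem_closedBall] at hp
    linarith
  have := Complex.dist_le_div_mul_dist_of_mapsTo_ball (hu.mono hsub)
    (fun w hw => by
      rw [h0, mem_closedBall_zero_iff]
      exact hB w (hsub hw)) hz
  rwa [h0, dist_zero_right] at this

variable {M : Type*} [NormedAddCommGroup M] [NormedSpace ℂ M]
  {X : Type*} [TopologicalSpace X] [ChartedSpace M X]
  {F : Type*} [NormedAddCommGroup F] [NormedSpace ℂ F]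
  {E : X → Type*} [TopologicalSpace (TotalSpace F E)]
  [∀ x, TopologicalSpace (E x)] [∀ x, AddCommGroup (E x)] [∀ x, Module ℂ (E x)]
  [FiberBundle F E] [VectorBundle ℂ F E] [ContMDiffVectorBundle ω F E 𝓘(ℂ, M)]

theorem contMDiffAt_trivialization_section (s : ContMDiffSection 𝓘(ℂ, M) F ω E)
    (e : Trivialization F (π F E)) [MemTrivializationAtlas e] {x : X} (hx : x ∈ e.baseSet) :
    ContMDiffAt 𝓘(ℂ, M) 𝓘(ℂ, F) ω (fun y => (e ⟨y, s y⟩).2) x :=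
  ((e.contMDiffAt_iff (IM := 𝓘(ℂ, M)) (IB := 𝓘(ℂ, M)) (n := ω) (x₀ := x)
    (f := fun y => (⟨y, s y⟩ : TotalSpace F E)) (e.mem_source.2 hx)).1 (s.contMDiff x)).2

/-- `K` and `L` are concentric closed balls of radii `2 * R` and `R` in a chart. The finite set `P`
depends on `η` but not on the section, which is what makes the estimate useful for a dimension
bound. -/
theorem exists_compact_nhds_finite_net [FiniteDimensional ℂ M] [IsManifold 𝓘(ℂ, M) ω X] (x : X) :
    ∃ K L : Set X, IsCompact K ∧ IsCompact L ∧ L ⊆ K ∧ K ⊆ (trivializationAt F E x).baseSet ∧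
      L ∈ nhds x ∧ ∀ η > (0 : ℝ), ∃ P : Set X, P.Finite ∧
        ∀ (s : ContMDiffSection 𝓘(ℂ, M) F ω E) (B : ℝ),
          (∀ y ∈ K, ‖(trivializationAt F E x ⟨y, s y⟩).2‖ ≤ B) → (∀ p ∈ P, s p = 0) →
          ∀ y ∈ L, ‖(trivializationAt F E x ⟨y, s y⟩).2‖ ≤ η * B := by
  have : ProperSpace M := FiniteDimensional.proper ℂ M
  set e := trivializationAt F E x
  set φ := chartAt M x
  have hx : x ∈ φ.source := mem_chart_source M x
  have hopen : IsOpen (φ.target ∩ φ.symm ⁻¹' e.baseSet) :=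
    φ.symm.isOpen_inter_preimage e.open_baseSet
  obtain ⟨ε, hε, hsub⟩ := Metric.nhds_basis_closedBall.mem_iff.1
    (hopen.mem_nhds (x := φ x) ⟨φ.map_source hx, by
      rw [Set.mem_preimage, φ.left_inv hx]
      exact FiberBundle.mem_baseSet_trivializationAt' x⟩)
  set R := ε / 2
  have hR : 0 < R := half_pos hε
  have h2R : ε = 2 * R := by simp only [R]; ring
  rw [h2R] at hsub
  have hsub' : Metric.closedBall (φ x) R ⊆ Metric.closedBall (φ x) (2 * R) :=
    Metric.closedBall_subset_closedBall (by linarith)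
  have hcont : ContinuousOn φ.symm (Metric.closedBall (φ x) (2 * R)) :=
    φ.continuousOn_symm.mono fun z hz => (hsub hz).1
  refine ⟨φ.symm '' Metric.closedBall (φ x) (2 * R), φ.symm '' Metric.closedBall (φ x) R,
    (isCompact_closedBall _ _).image_of_continuousOn hcont,
    (isCompact_closedBall _ _).image_of_continuousOn (hcont.mono hsub'), Set.image_mono hsub',
    ?_, ?_, fun η hη => ?_⟩
  · rintro _ ⟨z, hz, rfl⟩
    exact (hsub hz).2
  · have := φ.symm.image_mem_nhds (x := φ x) (φ.map_source hx) (Metric.closedBall_mem_nhds _ hR)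
    rwa [φ.left_inv hx] at this
  -- Mesh below `R` puts each point in a Schwarz ball about a net point; mesh below `η * R` turns
  -- the bound `B / R * dist z p` into `η * B`.
  · obtain ⟨P, hPsub, hPfin, hPcov⟩ := (isCompact_closedBall (φ x) R).finite_cover_balls
      (e := min R (η * R)) (lt_min hR (mul_pos hη hR))
    refine ⟨φ.symm '' P, hPfin.image _, fun s B hB hP => ?_⟩
    rintro _ ⟨z, hz, rfl⟩
    obtain ⟨p, hp, hzp⟩ := Set.mem_iUnion₂.1 (hPcov hz)
    have hdiff : DifferentiableOn ℂ (fun w => (e ⟨φ.symm w, s (φ.symm w)⟩).2)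
        (Metric.ball (φ x) (2 * R)) := by
      intro w hw
      have hw' := hsub (Metric.ball_subset_closedBall hw)
      have h1 : ContMDiffAt 𝓘(ℂ, M) 𝓘(ℂ, M) ω φ.symm w :=
        (contMDiffOn_chart_symm (I := 𝓘(ℂ, M)) (n := ω) (x := x)).contMDiffAt
          (φ.open_target.mem_nhds hw'.1)
      have h2 := (contMDiffAt_trivialization_section s e hw'.2).comp w h1
      exact (h2.contDiffAt.differentiableAt (by simp)).differentiableWithinAt
    have h0 : (e ⟨φ.symm p, s (φ.symm p)⟩).2 = 0 := by
      rw [hP _ ⟨p, hp, rfl⟩]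
      exact (e.linear ℂ (hsub (hsub' (hPsub hp))).2).map_zero
    have hB0 : 0 ≤ B := (norm_nonneg _).trans (hB _ ⟨z, hsub' hz, rfl⟩)
    rw [Metric.mem_ball, lt_min_iff] at hzp
    refine (norm_le_div_mul_dist_of_eq_zero hdiff
      (fun w hw => hB _ ⟨w, Metric.ball_subset_closedBall hw, rfl⟩) (hPsub hp) h0 hzp.1).trans ?_
    calc B / R * dist z p ≤ B / R * (η * R) := by gcongr; exact hzp.2.le
      _ = η * B := by field_simp

/-- The space of holomorphic sections of a holomorphic vector bundle of finite rank on a compact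
complex manifold is finite dimensional. -/
theorem finiteDimensional_contMDiffSection [FiniteDimensional ℂ M] [IsManifold 𝓘(ℂ, M) ω X]
    [T2Space X] [CompactSpace X] [FiniteDimensional ℂ F] :
    FiniteDimensional ℂ (ContMDiffSection 𝓘(ℂ, M) F ω E) := by
  choose K L hK hL hLK hKe hLx hnet using
    exists_compact_nhds_finite_net (M := M) (F := F) (E := E)
  obtain ⟨t, ht⟩ := CompactSpace.elim_nhds_subcover L hLx
  let e (i : X) := trivializationAt F E i
  have hC (i j : X) : ∃ C : ℝ, ∀ y ∈ K i ∩ L j, ‖((e j).coordChangeL ℂ (e i) y : F →L[ℂ] F)‖ ≤ C :=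
    ((hK i).inter (hL j)).exists_bound_of_continuousOn
      ((continuousOn_coordChange ℂ (e j) (e i)).mono fun y hy => ⟨hKe j (hLK j hy.2), hKe i hy.1⟩)
  choose C hC using hC
  obtain ⟨C', hC'⟩ : ∃ C' : ℝ, 0 < C' ∧ ∀ i ∈ t, ∀ j ∈ t, C i j ≤ C' := by
    obtain ⟨c, hc⟩ := (((t ×ˢ t).image fun q => C q.1 q.2)).exists_le
    refine ⟨max c 1, by positivity, fun i hi j hj => (hc _ ?_).trans (le_max_left _ _)⟩
    exact Finset.mem_image.2 ⟨(i, j), Finset.mem_product.2 ⟨hi, hj⟩, rfl⟩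
  -- Changing trivialization costs a factor of at most `C'`; this `η` leaves a net contraction by `1
  -- / 2`.
  have hη : 0 < 1 / (2 * C') := by have := hC'.1; positivity
  choose P hPfin hP using fun i => hnet i _ hη
  let Q : Set X := ⋃ i ∈ t, P i
  have hQ : Q.Finite := t.finite_toSet.biUnion fun i _ => hPfin i
  have : Finite Q := hQ
  have hfib (x : X) : FiniteDimensional ℂ (E x) :=
    LinearEquiv.finiteDimensional ((e x).linearEquivAt ℂ x
      (FiberBundle.mem_baseSet_trivializationAt' x)).symm
  let ev : ContMDiffSection 𝓘(ℂ, M) F ω E →ₗ[ℂ] ∀ q : Q, E q :=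
    { toFun := fun s q => s q
      map_add' := fun _ _ => rfl
      map_smul' := fun _ _ => rfl }
  refine FiniteDimensional.of_injective ev ((injective_iff_map_eq_zero ev).2 fun s hs => ?_)
  have hsQ (q : X) (hq : q ∈ Q) : s q = 0 := congrFun hs ⟨q, hq⟩
  obtain ⟨B, hB⟩ : ∃ B : ℝ, ∀ i ∈ t, ∀ y ∈ K i, ‖(e i ⟨y, s y⟩).2‖ ≤ B := by
    have hb (i : X) : ∃ B : ℝ, ∀ y ∈ K i, ‖(e i ⟨y, s y⟩).2‖ ≤ B :=
      (hK i).exists_bound_of_continuousOn fun y hy =>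
        (contMDiffAt_trivialization_section s (e i) (hKe i hy)).continuousAt.continuousWithinAt
    choose b hb using hb
    obtain ⟨B, hB⟩ := (t.image b).exists_le
    exact ⟨B, fun i hi y hy => (hb i y hy).trans (hB _ (Finset.mem_image_of_mem b hi))⟩
  -- A point of the large set `K i` lies in some small set `L j`. The net estimate holds there in
  -- the trivialization `e j` and is carried back to `e i`, so the bound is again on all of `K i`
  -- and can be iterated.
  have hstep (B : ℝ) (hB : ∀ i ∈ t, ∀ y ∈ K i, ‖(e i ⟨y, s y⟩).2‖ ≤ B) :
      ∀ i ∈ t, ∀ y ∈ K i, ‖(e i ⟨y, s y⟩).2‖ ≤ B * (1 / 2) := by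
    intro i hi y hy
    obtain ⟨j, hj, hyj⟩ : ∃ j ∈ t, y ∈ L j := by
      have : y ∈ ⋃ j ∈ t, L j := ht ▸ Set.mem_univ y
      simpa using this
    have h1 := hP j s B (hB j hj) (fun p hp => hsQ p (Set.mem_biUnion hj hp)) y hyj
    have hyj' : y ∈ (e j).baseSet := hKe j (hLK j hyj)
    have h2 : (e i ⟨y, s y⟩).2 = (e j).coordChangeL ℂ (e i) y (e j ⟨y, s y⟩).2 := by
      rw [(e j).coordChangeL_apply (e i) ⟨hyj', hKe i hy⟩, (e j).symm_apply_apply_mk hyj']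
    have hC0 := hC'.1
    rw [h2]
    calc _ ≤ ‖((e j).coordChangeL ℂ (e i) y : F →L[ℂ] F)‖ * ‖(e j ⟨y, s y⟩).2‖ :=
          ContinuousLinearMap.le_opNorm ((e j).coordChangeL ℂ (e i) y : F →L[ℂ] F) _
      _ ≤ C' * (1 / (2 * C') * B) := by
          gcongr
          exact (hC i j y ⟨hy, hyj⟩).trans (hC'.2 i hi j hj)
      _ = B * (1 / 2) := by field_simp
  have hpow (n : ℕ) : ∀ i ∈ t, ∀ y ∈ K i, ‖(e i ⟨y, s y⟩).2‖ ≤ B * (1 / 2) ^ n := by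
    induction n with
    | zero => simpa using hB
    | succ n ih =>
      rw [pow_succ, ← mul_assoc]
      exact hstep _ ih
  ext y
  obtain ⟨j, hj, hyj⟩ : ∃ j ∈ t, y ∈ L j := by
    have : y ∈ ⋃ j ∈ t, L j := ht ▸ Set.mem_univ y
    simpa using this
  have hlim : Filter.Tendsto (fun n : ℕ => B * (1 / 2 : ℝ) ^ n) Filter.atTop (nhds 0) := by
    simpa using (tendsto_pow_atTop_nhds_zero_of_lt_one (r := (1 / 2 : ℝ)) (by norm_num)
      (by norm_num)).const_mul B
  have hz : (e j ⟨y, s y⟩).2 = 0 :=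
    norm_le_zero_iff.1 (ge_of_tendsto' hlim fun n => hpow n j hj y (hLK j hyj))
  have hyj' : y ∈ (e j).baseSet := hKe j (hLK j hyj)
  exact ((e j).linearEquivAt ℂ y hyj').map_eq_zero_iff.1 hz

end Finiteness

/-! ## Endomorphisms and automorphisms of a holomorphic vector bundle -/

theorem contDiff_linearMap_det {F : Type*} [NormedAddCommGroup F] [NormedSpace ℂ F]
    [FiniteDimensional ℂ F] {n : WithTop ℕ∞} :
    ContDiff ℂ n fun A : F →L[ℂ] F => LinearMap.det (A : F →ₗ[ℂ] F) := by
  let b := Module.finBasis ℂ F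
  have h : (fun A : F →L[ℂ] F => LinearMap.det (A : F →ₗ[ℂ] F)) = fun A =>
      ∑ σ : Equiv.Perm _, ((Equiv.Perm.sign σ : ℤ) : ℂ) *
        ∏ i, (LinearMap.toContinuousLinearMap (b.coord (σ i))) (A (b i)) := by
    funext A
    rw [← LinearMap.det_toMatrix b, Matrix.det_apply']
    simp [LinearMap.toMatrix_apply]
  rw [h]
  refine ContDiff.sum fun σ _ => contDiff_const.mul (contDiff_prod fun i _ => ?_)
  fun_prop

section Endomorphisms

variable {M : Type*} [NormedAddCommGroup M] [NormedSpace ℂ M]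
  {X : Type*} [TopologicalSpace X] [ChartedSpace M X]
  {F : Type*} [NormedAddCommGroup F] [NormedSpace ℂ F]
  {E : X → Type*} [TopologicalSpace (TotalSpace F E)]
  [∀ x, TopologicalSpace (E x)] [∀ x, AddCommGroup (E x)] [∀ x, Module ℂ (E x)]
  [FiberBundle F E] [VectorBundle ℂ F E]

variable (F E) in
/-- The identification of a fibre with the model fibre. -/
def fiberEquiv (x : X) : E x ≃L[ℂ] F :=
  (trivializationAt F E x).continuousLinearEquivAt ℂ x
    (FiberBundle.mem_baseSet_trivializationAt' x)

variable (F) in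
include F in
theorem t2Space_fiber (x : X) : T2Space (E x) :=
  (fiberEquiv F E x).toHomeomorph.symm.t2Space

variable (F) in
include F in
theorem finiteDimensional_fiber [FiniteDimensional ℂ F] (x : X) : FiniteDimensional ℂ (E x) :=
  LinearEquiv.finiteDimensional (fiberEquiv F E x).symm.toLinearEquiv

/-- The determinant is invariant under conjugation by the trivialization, so it can be computed in
the fixed space `F`, where its holomorphy is visible. -/
theorem det_inCoordinates {x₀ x : X} (hx : x ∈ (trivializationAt F E x₀).baseSet)
    (f : E x →L[ℂ] E x) :
    LinearMap.det (ContinuousLinearMap.inCoordinates F E F E x₀ x x₀ x f : F →ₗ[ℂ] F) =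
      LinearMap.det (f : E x →ₗ[ℂ] E x) := by
  rw [ContinuousLinearMap.inCoordinates_eq hx hx]
  exact LinearMap.det_conj (f : E x →ₗ[ℂ] E x)
    ((trivializationAt F E x₀).continuousLinearEquivAt ℂ x hx).toLinearEquiv

variable [∀ x, IsTopologicalAddGroup (E x)] [∀ x, ContinuousSMul ℂ (E x)]

theorem detAt_mem_polyFunctions [FiniteDimensional ℂ F] (x : X) :
    detAt M F x ∈ polyFunctions (EndSections M F E) := by
  let b := (Module.finBasis ℂ F).map (fiberEquiv F E x).symm.toLinearEquiv
  have h : detAt M F x = fun f : EndSections M F E =>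
      (LinearMap.toMatrix b b (f x : E x →ₗ[ℂ] E x)).det := by
    funext f
    exact (LinearMap.det_toMatrix b _).symm
  rw [h]
  refine det_mem_polyFunctions _ fun i j => ?_
  let l : Module.Dual ℂ (EndSections M F E) :=
    { toFun := fun f => b.coord i (f x (b j))
      map_add' := fun f g => (b.coord i).map_add _ _
      map_smul' := fun c f => (b.coord i).map_smul _ _ }
  have : (fun f : EndSections M F E => LinearMap.toMatrix b b (f x : E x →ₗ[ℂ] E x) i j) =
      fun f => l f := by
    funext f
    rw [LinearMap.toMatrix_apply]
    rfl
  rw [this]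
  exact linearForm_mem_polyFunctions l

theorem EndSections.contMDiff_apply (f : EndSections M F E) :
    ContMDiff (𝓘(ℂ, M).prod 𝓘(ℂ, F)) (𝓘(ℂ, M).prod 𝓘(ℂ, F)) ω
      (fun p : TotalSpace F E => (⟨p.1, f p.1 p.2⟩ : TotalSpace F E)) :=
  ContMDiff.clm_bundle_apply (b := fun p : TotalSpace F E => p.1) (v := fun p => p.2)
    (ϕ := fun p => f p.1) (f.contMDiff.comp (contMDiff_proj E)) contMDiff_id

theorem contMDiff_detAt [IsManifold 𝓘(ℂ, M) ω X] [ContMDiffVectorBundle ω F E 𝓘(ℂ, M)]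
    [FiniteDimensional ℂ F] (f : EndSections M F E) :
    ContMDiff 𝓘(ℂ, M) 𝓘(ℂ, ℂ) ω fun x => detAt M F x f := by
  intro x₀
  have h := ((contMDiffAt_hom_bundle _).1 (f.contMDiff x₀)).2
  refine (contDiff_linearMap_det.contMDiff.contMDiffAt.comp x₀ h).congr_of_eventuallyEq ?_
  filter_upwards [(trivializationAt F E x₀).open_baseSet.mem_nhds
    (FiberBundle.mem_baseSet_trivializationAt' x₀)] with x hx
  exact (det_inCoordinates hx (f x)).symm

/-- Holomorphic functions on a compact connected manifold are constant, by the maximum principle. -/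
theorem detAt_eq_detAt [IsManifold 𝓘(ℂ, M) ω X] [ContMDiffVectorBundle ω F E 𝓘(ℂ, M)]
    [FiniteDimensional ℂ F] [CompactSpace X] [ConnectedSpace X] (f : EndSections M F E)
    (x y : X) : detAt M F x f = detAt M F y f :=
  ((contMDiff_detAt f).mdifferentiable (by simp)).apply_eq_of_compactSpace x y

/-- In a trivialization the fibrewise inverse is the composite of a holomorphic operator-valued map
with operator inversion, which is analytic at invertible operators. -/
theorem contMDiff_symm_apply [FiniteDimensional ℂ F] (g : ∀ x, E x ≃L[ℂ] E x)
    (hg : ContMDiff 𝓘(ℂ, M) (𝓘(ℂ, M).prod 𝓘(ℂ, F →L[ℂ] F)) ω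
      (fun x => TotalSpace.mk' (F →L[ℂ] F) (E := fun x => E x →L[ℂ] E x) x (g x))) :
    ContMDiff (𝓘(ℂ, M).prod 𝓘(ℂ, F)) (𝓘(ℂ, M).prod 𝓘(ℂ, F)) ω
      (fun p : TotalSpace F E => (⟨p.1, (g p.1).symm p.2⟩ : TotalSpace F E)) := by
  have : CompleteSpace F := FiniteDimensional.complete ℂ F
  intro p₀
  refine ContMDiffAt.clm_apply_of_inCoordinates (b₁ := fun p : TotalSpace F E => p.1)
    (b₂ := fun p => p.1) (v := fun p => p.2) (ϕ := fun p => ((g p.1).symm : E p.1 →L[ℂ] E p.1))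
    ?_ contMDiffAt_id (contMDiff_proj E p₀)
  set x₀ := p₀.1
  set e := trivializationAt F E x₀
  suffices h : ContMDiffAt 𝓘(ℂ, M) 𝓘(ℂ, F →L[ℂ] F) ω (fun x =>
      ContinuousLinearMap.inCoordinates F E F E x₀ x x₀ x ((g x).symm : E x →L[ℂ] E x)) x₀ from
    h.comp p₀ (contMDiff_proj E p₀)
  have hx₀ : x₀ ∈ e.baseSet := FiberBundle.mem_baseSet_trivializationAt' x₀
  let G (x : X) (hx : x ∈ e.baseSet) : F ≃L[ℂ] F :=
    ((e.continuousLinearEquivAt ℂ x hx).symm.trans (g x)).trans (e.continuousLinearEquivAt ℂ x hx)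
  have hG (x : X) (hx : x ∈ e.baseSet) :
      ContinuousLinearMap.inCoordinates F E F E x₀ x x₀ x (g x : E x →L[ℂ] E x) = G x hx :=
    ContinuousLinearMap.inCoordinates_eq hx hx
  have hG' (x : X) (hx : x ∈ e.baseSet) :
      ContinuousLinearMap.inCoordinates F E F E x₀ x x₀ x ((g x).symm : E x →L[ℂ] E x) =
        (G x hx).symm :=
    ContinuousLinearMap.inCoordinates_eq hx hx
  have h1 := ((contMDiffAt_hom_bundle _).1 (hg x₀)).2
  have h2 : ContMDiffAt 𝓘(ℂ, F →L[ℂ] F) 𝓘(ℂ, F →L[ℂ] F) ω ContinuousLinearMap.inverse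
      (ContinuousLinearMap.inCoordinates F E F E x₀ x₀ x₀ x₀ (g x₀ : E x₀ →L[ℂ] E x₀)) := by
    rw [hG x₀ hx₀]
    exact (contDiffAt_map_inverse (G x₀ hx₀)).contMDiffAt
  refine (h2.comp x₀ h1).congr_of_eventuallyEq ?_
  filter_upwards [e.open_baseSet.mem_nhds hx₀] with x hx
  rw [Function.comp_apply]
  rw [hG x hx, hG' x hx, ContinuousLinearMap.inverse_equiv]

variable [IsManifold 𝓘(ℂ, M) ω X] [ContMDiffVectorBundle ω F E 𝓘(ℂ, M)]

theorem BundleAut.toEndSection_injective [FiniteDimensional ℂ F] :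
    Function.Injective (BundleAut.toEndSection : BundleAut M F E → EndSections M F E) := by
  intro φ ψ h
  apply BundleAut.ext
  funext x
  ext v
  exact congrArg (fun f : EndSections M F E => f x v) h

theorem BundleAut.range_toEndSection [FiniteDimensional ℂ F] [CompactSpace X] [ConnectedSpace X]
    (x₀ : X) : Set.range (BundleAut.toEndSection : BundleAut M F E → EndSections M F E) =
      {f | detAt M F x₀ f ≠ 0} := by
  ext f
  constructor
  · rintro ⟨φ, rfl⟩
    exact (LinearEquiv.isUnit_det' (φ.toFun x₀).toLinearEquiv).ne_zero
  · intro hf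
    have hdet (x : X) : detAt M F x f ≠ 0 := by
      rw [detAt_eq_detAt f x x₀]
      exact hf
    have hT2 (x : X) : T2Space (E x) := t2Space_fiber F x
    have hfin (x : X) : FiniteDimensional ℂ (E x) := finiteDimensional_fiber F x
    let g (x : X) : E x ≃L[ℂ] E x := (f x).toContinuousLinearEquivOfDetNeZero (hdet x)
    have hg (x : X) : (g x : E x →L[ℂ] E x) = f x :=
      ContinuousLinearMap.coe_toContinuousLinearEquivOfDetNeZero _ _
    refine ⟨⟨g, ?_, contMDiff_symm_apply g ?_⟩, ?_⟩
    · exact f.contMDiff_apply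
    · simp only [hg]
      exact f.contMDiff
    · exact ContMDiffSection.ext fun x => hg x

/-- Composition of holomorphic sections of the endomorphism bundle. -/
def EndSections.comp [FiniteDimensional ℂ F] :
    EndSections M F E →ₗ[ℂ] EndSections M F E →ₗ[ℂ] EndSections M F E :=
  LinearMap.mk₂ ℂ
    (fun f g => ⟨fun x => (f x).comp (g x),
      contMDiff_end_section _ (f.contMDiff_apply.comp g.contMDiff_apply)⟩)
    (fun _ _ _ => ContMDiffSection.ext fun _ => ContinuousLinearMap.add_comp _ _ _)
    (fun _ _ _ => ContMDiffSection.ext fun _ => ContinuousLinearMap.smul_comp _ _ _)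
    (fun _ _ _ => ContMDiffSection.ext fun _ => ContinuousLinearMap.comp_add _ _ _)
    (fun _ _ _ => ContMDiffSection.ext fun _ => ContinuousLinearMap.comp_smul _ _ _)

theorem BundleAut.isAffineAlgebraicGroup [FiniteDimensional ℂ M] [FiniteDimensional ℂ F]
    [T2Space X] [CompactSpace X] [ConnectedSpace X] : IsAffineAlgebraicGroup
      (regularFunctions (BundleAut.toEndSection : BundleAut M F E → EndSections M F E)) := by
  have x₀ : X := Classical.arbitrary X
  have : FiniteDimensional ℂ (EndSections M F E) := finiteDimensional_contMDiffSection
  refine isAffineAlgebraicGroup_regularFunctions BundleAut.toEndSection_injective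
    (detAt_mem_polyFunctions x₀) (BundleAut.range_toEndSection x₀) (fun g h => ?_)
    EndSections.comp (fun g h => rfl) (fun g h v => rfl) (fun v => rfl)
  exact LinearMap.det_comp ((g.toFun x₀ : E x₀ →L[ℂ] E x₀) : E x₀ →ₗ[ℂ] E x₀)
    ((h.toFun x₀ : E x₀ →L[ℂ] E x₀) : E x₀ →ₗ[ℂ] E x₀)

end Endomorphisms

/-! ## Automorphisms of the sheaf of sections -/

/-- The domain of the preferred trivialization at a point. -/
def trivOpens {X : Type*} [TopologicalSpace X] (F : Type*) [TopologicalSpace F]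
    (E : X → Type*) [TopologicalSpace (TotalSpace F E)] [∀ x, TopologicalSpace (E x)]
    [FiberBundle F E] (x : X) : Opens X :=
  ⟨(trivializationAt F E x).baseSet, (trivializationAt F E x).open_baseSet⟩

theorem mem_trivOpens {X : Type*} [TopologicalSpace X] {F : Type*} [TopologicalSpace F]
    {E : X → Type*} [TopologicalSpace (TotalSpace F E)] [∀ x, TopologicalSpace (E x)]
    [FiberBundle F E] (x : X) : x ∈ trivOpens F E x :=
  FiberBundle.mem_baseSet_trivializationAt' x

section Sheaf

variable {M : Type*} [NormedAddCommGroup M] [NormedSpace ℂ M]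
  {X : Type*} [TopologicalSpace X] [ChartedSpace M X]
  {F : Type*} [NormedAddCommGroup F] [NormedSpace ℂ F]
  {E : X → Type*} [TopologicalSpace (TotalSpace F E)]
  [∀ x, TopologicalSpace (E x)] [∀ x, AddCommGroup (E x)] [∀ x, Module ℂ (E x)]
  [FiberBundle F E] [VectorBundle ℂ F E]

theorem sheafSections_smul_apply {U : Opens X} (a : HolFun M U) (s : sheafSections M F E U)
    (x : U) : (a • s).1 x = a x • s.1 x := rfl

theorem sheafSections_sum_apply {U : Opens X} {κ : Type*} (t : Finset κ)
    (s : κ → sheafSections M F E U) (x : U) : (∑ i ∈ t, s i).1 x = ∑ i ∈ t, (s i).1 x := by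
  rw [AddSubgroup.val_finsetSum, Finset.sum_apply]

variable [ContMDiffVectorBundle ω F E 𝓘(ℂ, M)]

variable (M E) in
/-- The local section that is constant in the preferred trivialization at a point. -/
def frameSection (x : X) (v : F) : sheafSections M F E (trivOpens F E x) :=
  ⟨fun y => (trivializationAt F E x).symm y v, fun y => by
    set e := trivializationAt F E x
    have h1 : ContMDiffAt 𝓘(ℂ, M) (𝓘(ℂ, M).prod 𝓘(ℂ, F)) ω
        (fun y : trivOpens F E x => e.toOpenPartialHomeomorph.symm ((y : X), v)) y := by
      have h2 := (e.contMDiffOn_symm (IB := 𝓘(ℂ, M)) (n := ω)).contMDiffAt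
        (x := ((y : X), v)) (e.open_target.mem_nhds (e.mem_target.2 y.2))
      exact h2.comp y ((contMDiff_subtype_val y).prodMk contMDiffAt_const)
    refine h1.congr_of_eventuallyEq (Filter.Eventually.of_forall fun z => ?_)
    exact e.mk_symm z.2 v⟩

theorem frameSection_apply (x : X) (v : F) (y : trivOpens F E x) :
    (frameSection M E x v).1 y = (trivializationAt F E x).symm y v := rfl

/-- Every vector of a fibre is the value of a local holomorphic section; hence a bundle map is
determined by its action on sections. -/
theorem frameSection_self (x : X) (v : E x) :
    (frameSection M E x (trivializationAt F E x ⟨x, v⟩).2).1 ⟨x, mem_trivOpens x⟩ = v :=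
  (trivializationAt F E x).symm_apply_apply_mk (mem_trivOpens x) v

theorem contMDiff_trivialization_sheafSections {U : Opens X} (s : sheafSections M F E U) (x : X)
    (hU : U ≤ trivOpens F E x) :
    ContMDiff 𝓘(ℂ, M) 𝓘(ℂ, F) ω fun y : U => (trivializationAt F E x ⟨y, s.1 y⟩).2 := fun y =>
  (((trivializationAt F E x).contMDiffAt_iff (IM := 𝓘(ℂ, M)) (IB := 𝓘(ℂ, M)) (n := ω) (x₀ := y)
    (f := fun y : U => (⟨y, s.1 y⟩ : TotalSpace F E))
    ((trivializationAt F E x).mem_source.2 (hU y.2))).1 (s.2 y)).2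

theorem BundleAut.toSheafAut_injective : Function.Injective (BundleAut.toSheafAut M F E) := by
  intro φ ψ h
  apply BundleAut.ext
  funext x
  ext v
  have h1 := congrArg (fun Φ : SheafAut M F E => (Φ.app _
    (frameSection M E x (trivializationAt F E x ⟨x, v⟩).2)).1 ⟨x, mem_trivOpens x⟩) h
  change φ.toFun x ((frameSection M E x (trivializationAt F E x ⟨x, v⟩).2).1 ⟨x, mem_trivOpens x⟩) =
    ψ.toFun x ((frameSection M E x (trivializationAt F E x ⟨x, v⟩).2).1 ⟨x, mem_trivOpens x⟩) at h1
  rwa [frameSection_self] at h1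

variable [FiniteDimensional ℂ F]

namespace SheafAut

variable (Φ : SheafAut M F E)

/-- Near `y`, write `s = ∑ aᵢ eᵢ` in a local frame. The coefficients vanish at `y`, and
`𝒪`-linearity pulls them out of `Φ`. -/
theorem app_apply_eq_zero {U : Opens X} (s : sheafSections M F E U) (y : U) (hs : s.1 y = 0) :
    (Φ.app U s).1 y = 0 := by
  set e := trivializationAt F E y.1
  let b := Module.finBasis ℂ F
  let W : Opens X := U ⊓ trivOpens F E y.1
  have hWU : W ≤ U := inf_le_left
  have hWe : W ≤ trivOpens F E y.1 := inf_le_right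
  let w : W := ⟨y, y.2, mem_trivOpens y.1⟩
  let a (i : Fin (Module.finrank ℂ F)) : HolFun M W :=
    ⟨fun z => LinearMap.toContinuousLinearMap (b.coord i) (e ⟨z, (resSection hWU s).1 z⟩).2,
      (ContinuousLinearMap.contMDiff _).comp
        (contMDiff_trivialization_sheafSections (resSection hWU s) y.1 hWe)⟩
  have ha (i) (z : W) : a i z = b.repr (e ⟨z, s.1 ⟨z, hWU z.2⟩⟩).2 i := rfl
  have hsum : resSection hWU s = ∑ i, a i • resSection hWe (frameSection M E y.1 (b i)) := by
    apply Subtype.ext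
    funext z
    have hz : (z : X) ∈ e.baseSet := hWe z.2
    rw [sheafSections_sum_apply]
    apply (e.linearEquivAt ℂ z hz).injective
    simp only [map_sum, sheafSections_smul_apply, map_smul]
    have h1 (i) : e.linearEquivAt ℂ z hz ((resSection hWe (frameSection M E y.1 (b i))).1 z) =
        b i := (e.linearEquivAt ℂ z hz).apply_symm_apply (b i)
    simp only [h1, ha]
    exact (b.sum_repr _).symm
  have h0 (i) : a i w = 0 := by
    rw [ha]
    have : (e ⟨y, s.1 y⟩).2 = 0 := by
      rw [hs]
      exact (e.linear ℂ (mem_trivOpens (F := F) (E := E) y.1)).map_zero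
    change b.repr (e ⟨y, s.1 y⟩).2 i = 0
    rw [this]
    simp
  have h1 : (Φ.app U s).1 y = (Φ.app W (resSection hWU s)).1 w := by
    rw [← Φ.naturality]
    rfl
  rw [h1, hsum, map_sum, sheafSections_sum_apply]
  refine Finset.sum_eq_zero fun i _ => ?_
  rw [map_smul, sheafSections_smul_apply, h0, zero_smul]

theorem app_apply_congr {U V : Opens X} (s : sheafSections M F E U) (t : sheafSections M F E V)
    {y : X} (hU : y ∈ U) (hV : y ∈ V) (h : s.1 ⟨y, hU⟩ = t.1 ⟨y, hV⟩) :
    (Φ.app U s).1 ⟨y, hU⟩ = (Φ.app V t).1 ⟨y, hV⟩ := by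
  have hWU : U ⊓ V ≤ U := inf_le_left
  have hWV : U ⊓ V ≤ V := inf_le_right
  have h1 := Φ.app_apply_eq_zero (resSection hWU s - resSection hWV t) ⟨y, hU, hV⟩
    (sub_eq_zero.2 h)
  rw [map_sub, ← Φ.naturality, ← Φ.naturality] at h1
  exact sub_eq_zero.1 h1

/-- The endomorphism of the fibre at a point induced by a sheaf automorphism. -/
def fiberMap (x : X) : E x →ₗ[ℂ] E x where
  toFun v := (Φ.app _ (frameSection M E x (trivializationAt F E x ⟨x, v⟩).2)).1
    ⟨x, mem_trivOpens x⟩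
  map_add' v w := by
    have h := Φ.app_apply_congr (frameSection M E x (trivializationAt F E x ⟨x, v + w⟩).2)
      (frameSection M E x (trivializationAt F E x ⟨x, v⟩).2 +
        frameSection M E x (trivializationAt F E x ⟨x, w⟩).2) (mem_trivOpens x) (mem_trivOpens x)
      ((frameSection_self x _).trans
        (congrArg₂ (· + ·) (frameSection_self x v) (frameSection_self x w)).symm)
    rw [h, map_add]
    rfl
  map_smul' c v := by
    let c' : HolFun M (trivOpens F E x) := ⟨fun _ => c, contMDiff_const⟩
    have h := Φ.app_apply_congr (frameSection M E x (trivializationAt F E x ⟨x, c • v⟩).2)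
      (c' • frameSection M E x (trivializationAt F E x ⟨x, v⟩).2)
      (mem_trivOpens x) (mem_trivOpens x)
      ((frameSection_self x _).trans (congrArg (c • ·) (frameSection_self x v)).symm)
    rw [h, map_smul]
    rfl

theorem fiberMap_apply {U : Opens X} (s : sheafSections M F E U) (x : U) :
    Φ.fiberMap x.1 (s.1 x) = (Φ.app U s).1 x :=
  Φ.app_apply_congr _ s (mem_trivOpens x.1) x.2 (frameSection_self x.1 _)

theorem fiberMap_inv_apply (x : X) (v : E x) : Φ.fiberMap x (Φ⁻¹.fiberMap x v) = v := by
  have h := Φ.fiberMap_apply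
    (Φ⁻¹.app _ (frameSection M E x (trivializationAt F E x ⟨x, v⟩).2)) ⟨x, mem_trivOpens x⟩
  refine h.trans ?_
  have : Φ.app _ (Φ⁻¹.app _ (frameSection M E x (trivializationAt F E x ⟨x, v⟩).2)) =
    frameSection M E x (trivializationAt F E x ⟨x, v⟩).2 := LinearEquiv.apply_symm_apply _ _
  rw [this]
  exact frameSection_self x v

/-- In a trivialization the fibre maps form a matrix whose columns are the images under `Φ` of the
frame sections; these are holomorphic because `Φ` takes values in `ℰ`. -/
theorem contMDiff_fiberMap :
    ContMDiff (𝓘(ℂ, M).prod 𝓘(ℂ, F)) (𝓘(ℂ, M).prod 𝓘(ℂ, F)) ω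
      (fun p : TotalSpace F E => (⟨p.1, Φ.fiberMap p.1 p.2⟩ : TotalSpace F E)) := by
  intro p₀
  set x₀ := p₀.1
  set e := trivializationAt F E x₀
  let b := Module.finBasis ℂ F
  refine contMDiffAt_totalSpace.2 ⟨contMDiff_proj E p₀, ?_⟩
  have hcoord : ContMDiffAt (𝓘(ℂ, M).prod 𝓘(ℂ, F)) 𝓘(ℂ, F) ω
      (fun p : TotalSpace F E => (e p).2) p₀ :=
    (contMDiffAt_totalSpace.1 contMDiffAt_id).2
  have hframe (v : F) : ContMDiffAt 𝓘(ℂ, M) 𝓘(ℂ, F) ω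
      (fun x => (e ⟨x, Φ.fiberMap x (e.symm x v)⟩).2) x₀ := by
    refine (contMDiffAt_subtype_iff (U := trivOpens F E x₀) (x := ⟨x₀, mem_trivOpens x₀⟩)).1 ?_
    refine (contMDiff_trivialization_sheafSections
      (Φ.app _ (frameSection M E x₀ v)) x₀ le_rfl _).congr_of_eventuallyEq
      (Filter.Eventually.of_forall fun x => ?_)
    dsimp only
    rw [← Φ.fiberMap_apply, frameSection_apply]
  have hframe' (v : F) : ContMDiffAt (𝓘(ℂ, M).prod 𝓘(ℂ, F)) 𝓘(ℂ, F) ω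
      (fun p : TotalSpace F E => (e ⟨p.1, Φ.fiberMap p.1 (e.symm p.1 v)⟩).2) p₀ :=
    ContMDiffAt.comp (g := fun x => (e ⟨x, Φ.fiberMap x (e.symm x v)⟩).2)
      (f := fun p : TotalSpace F E => p.1) p₀ (hframe v) (contMDiff_proj E p₀)
  have hsum : ContMDiffAt (𝓘(ℂ, M).prod 𝓘(ℂ, F)) 𝓘(ℂ, F) ω (fun p : TotalSpace F E =>
      ∑ i, LinearMap.toContinuousLinearMap (b.coord i) (e p).2 •
        (e ⟨p.1, Φ.fiberMap p.1 (e.symm p.1 (b i))⟩).2) p₀ :=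
    contMDiffAt_finsetSum fun i _ =>
      ((ContinuousLinearMap.contMDiff _).contMDiffAt.comp p₀ hcoord).smul
        (hframe' (b i))
  refine hsum.congr_of_eventuallyEq ?_
  filter_upwards [(contMDiff_proj (n := ω) (IB := 𝓘(ℂ, M)) (F := F) E).continuous.continuousAt
    (e.open_baseSet.mem_nhds (mem_trivOpens (F := F) (E := E) x₀))] with p hp
  have hp : p.1 ∈ e.baseSet := hp
  let l : F →ₗ[ℂ] F := (e.linearEquivAt ℂ p.1 hp).toLinearMap ∘ₗ Φ.fiberMap p.1 ∘ₗ
    (e.linearEquivAt ℂ p.1 hp).symm.toLinearMap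
  have h1 : (e ⟨p.1, Φ.fiberMap p.1 p.2⟩).2 = l (e p).2 := by
    change _ = (e ⟨p.1, Φ.fiberMap p.1 (e.symm p.1 (e ⟨p.1, p.2⟩).2)⟩).2
    rw [e.symm_apply_apply_mk hp]
  change (e ⟨p.1, Φ.fiberMap p.1 p.2⟩).2 = _
  rw [h1]
  conv_lhs => rw [← b.sum_repr (e p).2, map_sum]
  refine Finset.sum_congr rfl fun i _ => ?_
  rw [map_smul]
  rfl

variable [∀ x, IsTopologicalAddGroup (E x)] [∀ x, ContinuousSMul ℂ (E x)]

/-- The bundle automorphism induced by an automorphism of the sheaf of sections. -/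
def toBundleAut : BundleAut M F E where
  toFun x :=
    have := t2Space_fiber (E := E) F x
    have := finiteDimensional_fiber (E := E) F x
    (LinearEquiv.ofLinearMap (Φ.fiberMap x) (Φ⁻¹.fiberMap x)
      (LinearMap.ext (Φ.fiberMap_inv_apply x))
      (LinearMap.ext fun v => Φ⁻¹.fiberMap_inv_apply x v)).toContinuousLinearEquiv
  holomorphic := Φ.contMDiff_fiberMap
  holomorphic_symm := Φ⁻¹.contMDiff_fiberMap

theorem toSheafAut_toBundleAut : BundleAut.toSheafAut M F E Φ.toBundleAut = Φ := by
  apply SheafAut.ext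
  funext U
  apply LinearEquiv.ext
  intro s
  exact Subtype.ext (funext fun x => Φ.fiberMap_apply s x)

end SheafAut

end Sheaf

end

theorem mainTheorem9
    {M : Type*} [NormedAddCommGroup M] [NormedSpace ℂ M] [FiniteDimensional ℂ M]
    {X : Type*} [TopologicalSpace X] [ChartedSpace M X] [IsManifold 𝓘(ℂ, M) ω X]
    [T2Space X] [CompactSpace X] [ConnectedSpace X]
    {F : Type*} [NormedAddCommGroup F] [NormedSpace ℂ F] [FiniteDimensional ℂ F]
    (E : X → Type*) [TopologicalSpace (TotalSpace F E)]
    [∀ x, TopologicalSpace (E x)] [∀ x, AddCommGroup (E x)] [∀ x, Module ℂ (E x)]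
    [∀ x, IsTopologicalAddGroup (E x)] [∀ x, ContinuousSMul ℂ (E x)]
    [FiberBundle F E] [VectorBundle ℂ F E] [ContMDiffVectorBundle ω F E 𝓘(ℂ, M)] :
    -- `Aut(E)` is, through the natural map, the group `Aut(ℰ)` of the associated sheaf
    Function.Bijective (BundleAut.toSheafAut M F E) ∧
    -- `H⁰(X, End E)` is finite dimensional and contains `Aut(E)`
    FiniteDimensional ℂ (EndSections M F E) ∧
    Function.Injective (BundleAut.toEndSection : BundleAut M F E → EndSections M F E) ∧
    -- `Aut(E)` is the complement of the determinant hypersurface, at each base point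
    (∀ x₀ : X, detAt M F x₀ ∈ polyFunctions (EndSections M F E) ∧
      Set.range (BundleAut.toEndSection : BundleAut M F E → EndSections M F E) =
        {f | detAt M F x₀ f ≠ 0}) ∧
    -- with the regular functions of this Zariski open set, it is an affine algebraic group
    IsAffineAlgebraicGroup
      (regularFunctions (BundleAut.toEndSection : BundleAut M F E → EndSections M F E)) := by
  exact ⟨⟨BundleAut.toSheafAut_injective, fun Φ => ⟨Φ.toBundleAut, Φ.toSheafAut_toBundleAut⟩⟩,
    finiteDimensional_contMDiffSection, BundleAut.toEndSection_injective,
    fun x₀ => ⟨detAt_mem_polyFunctions x₀, BundleAut.range_toEndSection x₀⟩,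
    BundleAut.isAffineAlgebraicGroup⟩
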